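/- **Network.** A tree network consists of $n\ge 1$ servers, $m$ flows and a successor map: every server $j$ has a unique successor $\mathrm{su}(j)$, which is a server, except the sink, whose successor is the exit, written $n+1$; every server is connected to the exit by iterating $\mathrm{su}$. The depth is $d(n+1)=0$, $d(j)=d(\mathrm{su}(j))+1$. Flow $i$ follows a non-empty path of the tree; $\mathrm{fl}(j)$ is the set of flows crossing $j$. Flow $i$ has a token-bucket arrival curve $\gamma_{b_i,r_i}$ ($0\mapsto 0$, $t\mapsto b_i+r_it$ for $t>0$) and server $j$ a rate-latency service curve $\beta_j(t)=R_j\,(t-T_j)_+$, with $b_i,r_i,R_j,T_j\ge 0$. **Trajectories.** A trajectory gives, for each flow $i$ and each server $j$ of its path, the cumulative process $F_i^{(j)}$ entering $j$; the process leaving $j$ is $F_i^{(\mathrm{su}(j))}$ (also when $j$ is the last server of flow $i$). Cumulative processes are non-decreasing, left-continuous and null at $0$. The trajectory is admissible if - $F_i^{(j)}(t)-F_i^{(j)}(s)\le\gamma_{b_i,r_i}(t-s)$ for $0\le s\le t$, where $j$ is the first server of flow $i$; - $F_i^{(\mathrm{su}(j))}\le F_i^{(j)}$ for all $j$ and $i\in\mathrm{fl}(j)$;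 - $\sum_{i\in \mathrm{fl}(j)}F_i^{(\mathrm{su}(j))}(t)\ge\inf_{0\le s\le t}\big(\sum_{i\in \mathrm{fl}(j)}F_i^{(j)}(s)+\beta_j(t-s)\big)$ for all $j$ and $t\ge 0$; - (FIFO) data are served in their arrival order, and the data leaving a server enter the next one in the order in which they were served, even if they leave simultaneously. Precisely, for each server $j$ there is a set $C_j$ of vectors $(c_i)_{i\in \mathrm{fl}(j)}$ (the prefixes of the arrival order), totally ordered componentwise, that contains $(F_i^{(j)}(t))_i$ and $(F_i^{(\mathrm{su}(j))}(t))_i$ for all $t\ge 0$, and such that if $h=\mathrm{su}(j)$ is a server, every $c\in C_h$ agrees on $\mathrm{fl}(j)\cap \mathrm{fl}(h)$ with some $c'\in C_j$. Fix a flow $i_0$, the flow of interest, that ends at the sink, with first server $j_0$; let $A=F_{i_0}^{(j_0)}$ and $D=F_{i_0}^{(n+1)}$. Its worst-case delay $d$ is the supremum over admissible trajectories and $t\ge0$ of $\sup\{\delta\in[0,t] : A(t-\delta)>D(t)\}$ (with $\sup\emptyset=0$), and its worst-case backlog $b$ is the supremum of $A(t)-D(t)$. **Linear program.** The variables are dates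 $\mathbf t_{j,0},\dots,\mathbf t_{j,d(j)}$ for each server $j$, one date $\mathbf t_0=\mathbf t_{n+1,0}$, and, for each flow $i$, each $j$ on its path or equal to the successor of its last server, and $0\le k\le d(j)$, a variable $\mathbf F_i^{(j)}(\mathbf t_{j,k})$. With $h=\mathrm{su}(j)$, the constraints are: - time: $\mathbf t_{j,k+1}\le\mathbf t_{j,k}$ for $0\le k<d(j)$, and $\mathbf t_{j,k}\le \mathbf t_{h,k}$ for $0\le k\le d(h)$, for every server $j$; - FIFO: $\mathbf F_i^{(j)}(\mathbf t_{j,k})=\mathbf F_i^{(h)}(\mathbf t_{h,k})$ for every server $j$, $i\in\mathrm{fl}(j)$, $0\le k\le d(h)$; - service: for every server $j$, $\sum_{i\in\mathrm{fl}(j)}\mathbf F_i^{(h)}(\mathbf t_{h,d(h)})\ge\sum_{i\in\mathrm{fl}(j)}\mathbf F_i^{(j)}(\mathbf t_{j,d(j)})+\max\big(0,\,R_j(\mathbf t_{h,d(h)}-\mathbf t_{j,d(j)})-R_jT_j\big)$, written as two linear inequalities; - arrival: $\mathbf F_i^{(j)}(\mathbf t_{j,u})-\mathbf F_i^{(j)}(\mathbf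 t_{j,v})\le b_i+r_i(\mathbf t_{j,u}-\mathbf t_{j,v})$ for every flow $i$ with first server $j$ and $0\le u<v\le d(j)$; - monotony: $\mathbf F_i^{(j)}(\mathbf t_{j,k})\ge\mathbf F_i^{(j)}(\mathbf t_{j,k+1})$ for every flow $i$ with first server $j$ and $0\le k<d(j)$. The delay program maximizes $\mathbf t_0-\mathbf t_{j_0,0}$. The backlog program has one more variable $\mathbf F_{i_0}^{(j_0)}(\mathbf t_0)$ and the further constraints $\mathbf F_{i_0}^{(j_0)}(\mathbf t_0)-\mathbf F_{i_0}^{(j_0)}(\mathbf t_{j_0,u})\le b_{i_0}+r_{i_0}(\mathbf t_0-\mathbf t_{j_0,u})$ for $0\le u\le d(j_0)$, and maximizes $\mathbf F_{i_0}^{(j_0)}(\mathbf t_0)-\mathbf F_{i_0}^{(n+1)}(\mathbf t_0)$. **Theorem.** 1. The optimal value $D^*\in[-\infty,+\infty]$ of the delay program satisfies $D^*\ge d$. 2. The optimal value $B^*\in[-\infty,+\infty]$ of the backlog program satisfies $B^*\ge b$. Moreover, the programs have polynomial size: the variables and constraints listed above comprise at most $(n+1)(n+2)/2$ time variables, $m(n+1)(n+2)/2$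 process variables, $n(n+1)$ time constraints, $2n$ service constraints, and $mn(n+1)/2$ constraints of each of the types FIFO, arrival and monotony (the backlog program has one more variable and $d(j_0)+1$ more constraints). -/

import Mathlib

open scoped ENNReal

noncomputable section

namespace FifoTree

/-! ### Curves and cumulative processes -/

/-- Token-bucket curve `γ_{b,r}`: `0 ↦ 0` and `t ↦ b + r t` for `t > 0`. -/
def tokenBucket (b r : ℝ) (t : ℝ) : ℝ := if t ≤ 0 then 0 else b + r * t

/-- Rate-latency curve `β_{R,T} : t ↦ R (t - T)₊`. -/
def rateLatency (R T : ℝ) (t : ℝ) : ℝ := R * max (t - T) 0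

/-- (min,plus) convolution `(f * g)(t) = inf_{0 ≤ s ≤ t} f(s) + g(t - s)`. -/
def minPlusConv (f g : ℝ → ℝ) (t : ℝ) : ℝ := ⨅ s : Set.Icc (0 : ℝ) t, (f s + g (t - s))

/-- Cumulative processes: null at zero, non-decreasing and left-continuous on `[0, ∞)`
(values at negative times are irrelevant). -/
structure IsCumulative (f : ℝ → ℝ) : Prop where
  zero : f 0 = 0
  mono : MonotoneOn f (Set.Ici 0)
  leftCont : ∀ t, 0 < t → ContinuousWithinAt f (Set.Iic t) t

/-- `A` is `α`-constrained: `A(t) - A(s) ≤ α(t - s)` for all `0 ≤ s ≤ t`. -/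
def IsConstrained (A α : ℝ → ℝ) : Prop :=
  ∀ s t, 0 ≤ s → s ≤ t → A t - A s ≤ α (t - s)

/-- Worst delay between an arrival process `A` and a departure process `D`: the supremum over
`t ≥ 0` of `d(t) = sup {d ≥ 0 | A(t - d) > D(t)}`, where the supremum of the empty set is `0`. -/
def delay (A D : ℝ → ℝ) : ℝ≥0∞ :=
  ⨆ (t : ℝ) (_ : 0 ≤ t) (d : ℝ) (_ : 0 ≤ d ∧ d ≤ t ∧ D t < A (t - d)), ENNReal.ofReal d

/-- Worst backlog: the supremum over `t ≥ 0` of `A(t) - D(t)`. -/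
def backlog (A D : ℝ → ℝ) : ℝ≥0∞ :=
  ⨆ (t : ℝ) (_ : 0 ≤ t), ENNReal.ofReal (A t - D t)

/-! ### Tree networks -/

/-- A tree network with `n` servers and `m` flows. `su j` is the successor of the server `j`; the
value `none` stands for the exit of the network (written `n + 1` on paper), and it is the successor
of the sink only. Every server is connected to the exit, so that the servers form a tree directed
towards the sink. Flow `i` follows the arcs of the tree along `path i`, has arrival curve
`γ_{b i, r i}`, and server `j` has service curve `β_{R j, T j}`. -/
structure TreeNetwork (n m : ℕ) where
  sink : Fin n
  su : Fin n → Option (Fin n)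
  su_eq_none : ∀ j, su j = none ↔ j = sink
  reaches : ∀ j, ∃ k : ℕ, (fun o => Option.bind o su)^[k] (some j) = none
  path : Fin m → List (Fin n)
  path_ne_nil : ∀ i, path i ≠ []
  path_chain : ∀ i, (path i).IsChain (fun a c => su a = some c)
  b : Fin m → ℝ
  r : Fin m → ℝ
  R : Fin n → ℝ
  T : Fin n → ℝ
  b_nonneg : ∀ i, 0 ≤ b i
  r_nonneg : ∀ i, 0 ≤ r i
  R_nonneg : ∀ j, 0 ≤ R j
  T_nonneg : ∀ j, 0 ≤ T j

namespace TreeNetwork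

variable {n m : ℕ} (N : TreeNetwork n m)

/-- First server crossed by flow `i`. -/
def first (i : Fin m) : Fin n := (N.path i).head (N.path_ne_nil i)

/-- Last server crossed by flow `i`. -/
def last (i : Fin m) : Fin n := (N.path i).getLast (N.path_ne_nil i)

/-- The flows crossing server `j`. -/
def fl (j : Fin n) : Finset (Fin m) := Finset.univ.filter (fun i => j ∈ N.path i)

/-- The points at which flow `i` has a cumulative process: the servers of its path and the
successor of its last server. -/
def Visits (i : Fin m) (o : Option (Fin n)) : Prop :=
  (∃ j ∈ N.path i, o = some j) ∨ o = N.su (N.last i)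

theorem exists_exit (o : Option (Fin n)) :
    ∃ k : ℕ, (fun o => Option.bind o N.su)^[k] o = none := by
  cases o with
  | none => exact ⟨0, rfl⟩
  | some j => exact N.reaches j

/-- Depth: number of arcs from a point to the exit. The exit has depth `0`, the sink depth `1`. -/
def depth (o : Option (Fin n)) : ℕ :=
  Nat.find (N.exists_exit o)

theorem depth_none : N.depth none = 0 := by
  simp [depth]

theorem depth_some (j : Fin n) : N.depth (some j) = N.depth (N.su j) + 1 := by
  exact Nat.find_comp_succ (N.exists_exit (some j)) (N.exists_exit (N.su j)) (by simp)

theorem visits_first (i : Fin m) : N.Visits i (some (N.first i)) :=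
  Or.inl ⟨_, List.head_mem _, rfl⟩

theorem visits_of_mem {i : Fin m} {j : Fin n} (h : i ∈ N.fl j) : N.Visits i (some j) :=
  Or.inl ⟨j, by simpa [fl] using h, rfl⟩

theorem chain_su (l : List (Fin n)) (hl : l ≠ [])
    (hc : l.IsChain (fun a c => N.su a = some c)) (j : Fin n) (hj : j ∈ l) :
    (∃ k ∈ l, N.su j = some k) ∨ N.su j = N.su (l.getLast hl) := by
  induction l with
  | nil => exact absurd rfl hl
  | cons a l ih =>
    cases l with
    | nil => right; simp at hj; simp [hj]
    | cons c l =>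
      rw [List.isChain_cons_cons] at hc
      rcases List.mem_cons.1 hj with rfl | hj
      · exact Or.inl ⟨c, by simp, hc.1⟩
      · rcases ih (by simp) hc.2 hj with ⟨k, hk, h⟩ | h
        · exact Or.inl ⟨k, List.mem_cons_of_mem _ hk, h⟩
        · right; rw [h, List.getLast_cons (List.cons_ne_nil c l)]

theorem visits_su {i : Fin m} {j : Fin n} (h : i ∈ N.fl j) : N.Visits i (N.su j) :=
  N.chain_su _ (N.path_ne_nil i) (N.path_chain i) j (by simpa [fl] using h)

/-! ### Admissible trajectories -/

/-- A trajectory: `F i (some j)` is the process of flow `i` entering server `j`. For `j` on the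
path of flow `i`, the process leaving `j` is `F i (N.su j)`. -/
abbrev Trajectory (_N : TreeNetwork n m) : Type := Fin m → Option (Fin n) → ℝ → ℝ

/-- FIFO policy: data are served in their arrival order. The arrival order at server `j` is given
by the family `C j` of its prefixes: a prefix is a vector telling how much data of each flow
crossing `j` comes before some point of the order, so that prefixes are totally ordered.
* the data that have arrived before any time `t` form a prefix, and, as the service follows the
  order, so do the data that have departed before `t`;
* data go from a server `j` to the next server `h` in the order in which `j` serves them (also those
  that depart from `j` at the same instant): what a prefix at `h` contains of the flows coming from
  `j` is what a prefix at `j` contains of these flows.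
The order of data that arrive simultaneously from different origins is arbitrary. -/
def IsFIFO (F : N.Trajectory) : Prop :=
  ∃ C : Fin n → Set (Fin m → ℝ),
    (∀ j, ∀ c ∈ C j, ∀ c' ∈ C j,
      (∀ i ∈ N.fl j, c i ≤ c' i) ∨ (∀ i ∈ N.fl j, c' i ≤ c i)) ∧
    (∀ j t, 0 ≤ t → (fun i => F i (some j) t) ∈ C j) ∧
    (∀ j t, 0 ≤ t → (fun i => F i (N.su j) t) ∈ C j) ∧
    (∀ j h, N.su j = some h → ∀ c ∈ C h, ∃ c' ∈ C j, ∀ i ∈ N.fl j ∩ N.fl h, c' i = c i)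

/-- Admissible trajectories: cumulative processes satisfying the arrival, causality, service and
FIFO constraints. -/
structure IsAdmissible (F : N.Trajectory) : Prop where
  cumulative : ∀ i o, N.Visits i o → IsCumulative (F i o)
  arrival : ∀ i, IsConstrained (F i (some (N.first i))) (tokenBucket (N.b i) (N.r i))
  causal : ∀ j, ∀ i ∈ N.fl j, ∀ t, 0 ≤ t → F i (N.su j) t ≤ F i (some j) t
  service : ∀ j t, 0 ≤ t →
    minPlusConv (fun s => ∑ i ∈ N.fl j, F i (some j) s) (rateLatency (N.R j) (N.T j)) t
      ≤ ∑ i ∈ N.fl j, F i (N.su j) t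
  fifo : N.IsFIFO F

/-- Worst-case end-to-end delay of flow `i` over all admissible trajectories. -/
def worstCaseDelay (i : Fin m) : ℝ≥0∞ :=
  ⨆ (F : N.Trajectory) (_ : N.IsAdmissible F),
    delay (F i (some (N.first i))) (F i (N.su (N.last i)))

/-- Worst-case end-to-end backlog of flow `i` over all admissible trajectories. -/
def worstCaseBacklog (i : Fin m) : ℝ≥0∞ :=
  ⨆ (F : N.Trajectory) (_ : N.IsAdmissible F),
    backlog (F i (some (N.first i))) (F i (N.su (N.last i)))

end TreeNetwork

/-! ### Linear programs -/

/-- A (maximization) linear program: finitely many real variables, inequality constraints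
`lhs c x ≤ rhs c`, equality constraints `eqn c x = 0`, and a linear objective. -/
structure LinearProgram where
  Var : Type
  Ineq : Type
  Eqn : Type
  finite_var : Finite Var
  finite_ineq : Finite Ineq
  finite_eqn : Finite Eqn
  lhs : Ineq → (Var → ℝ) →ₗ[ℝ] ℝ
  rhs : Ineq → ℝ
  eqn : Eqn → (Var → ℝ) →ₗ[ℝ] ℝ
  objective : (Var → ℝ) →ₗ[ℝ] ℝ

/-- Feasible points. -/
def LinearProgram.Feasible (P : LinearProgram) (x : P.Var → ℝ) : Prop :=
  (∀ c, P.lhs c x ≤ P.rhs c) ∧ (∀ c, P.eqn c x = 0)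

/-- Optimal value, in `[-∞, +∞]` (`+∞` if the program is unbounded). -/
def LinearProgram.value (P : LinearProgram) : EReal :=
  ⨆ (x : P.Var → ℝ) (_ : P.Feasible x), ((P.objective x : ℝ) : EReal)

/-! ### The polynomial-size linear program of a tree network -/

namespace TreeNetwork

variable {n m : ℕ} (N : TreeNetwork n m)

/-- Time variables: `d(j) + 1` dates `t_{j,0}, …, t_{j,d(j)}` for each server `j` (the dates
`t_{u_min(j)}, …, t_{u_max(j)}`), and one date `t_0` for the exit. -/
abbrev TimeIx : Type := Σ o : Option (Fin n), Fin (N.depth o + 1)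

/-- Process variables: one for flow `i`, a point `o` that it visits and a date of `o`. -/
abbrev ProcIx : Type := Σ i : Fin m, Σ o : {o // N.Visits i o}, Fin (N.depth o + 1)

/-- All the variables. -/
abbrev Var : Type := N.TimeIx ⊕ N.ProcIx

/-- The time variable `t_{o,k}`. -/
def tv (o : Option (Fin n)) (k : Fin (N.depth o + 1)) : (N.Var → ℝ) →ₗ[ℝ] ℝ :=
  LinearMap.proj (Sum.inl ⟨o, k⟩)

/-- The date `t_0` of the exit of the network. -/
def t0 : (N.Var → ℝ) →ₗ[ℝ] ℝ := N.tv none 0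

/-- The process variable `F_i^{(o)}(t_{o,k})`. -/
def fv (i : Fin m) (o : Option (Fin n)) (h : N.Visits i o) (k : Fin (N.depth o + 1)) :
    (N.Var → ℝ) →ₗ[ℝ] ℝ :=
  LinearMap.proj (Sum.inr ⟨i, ⟨o, h⟩, k⟩)

/-- A position among the dates of `su j`, as a position among the dates of `j`. -/
def lift (j : Fin n) (k : Fin (N.depth (N.su j) + 1)) : Fin (N.depth (some j) + 1) :=
  ⟨k, by rw [N.depth_some]; omega⟩

/-- Order of the dates of a server: `t_{j,k+1} ≤ t_{j,k}` for `0 ≤ k < d(j)`. -/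
abbrev OrderIx : Type := Σ j : Fin n, Fin (N.depth (some j))

def orderRow (c : N.OrderIx) : (N.Var → ℝ) →ₗ[ℝ] ℝ :=
  N.tv (some c.1) c.2.succ - N.tv (some c.1) c.2.castSucc

/-- FIFO order of the dates: `t_{j,k} ≤ t_{h,k}` for `h = su j` and `0 ≤ k ≤ d(h)`. -/
abbrev FifoTimeIx : Type := Σ j : Fin n, Fin (N.depth (N.su j) + 1)

def fifoTimeRow (c : N.FifoTimeIx) : (N.Var → ℝ) →ₗ[ℝ] ℝ :=
  N.tv (some c.1) (N.lift c.1 c.2) - N.tv (N.su c.1) c.2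

/-- FIFO constraints: `F_i^{(j)}(t_{j,k}) = F_i^{(h)}(t_{h,k})` for `h = su j`, `i ∈ fl j` and
`0 ≤ k ≤ d(h)`. -/
abbrev FifoIx : Type := Σ j : Fin n, {i // i ∈ N.fl j} × Fin (N.depth (N.su j) + 1)

def fifoRow (c : N.FifoIx) : (N.Var → ℝ) →ₗ[ℝ] ℝ :=
  N.fv c.2.1 (some c.1) (N.visits_of_mem c.2.1.2) (N.lift c.1 c.2.2)
    - N.fv c.2.1 (N.su c.1) (N.visits_su c.2.1.2) c.2.2

/-- Two service inequalities per server `j`, at the last dates of `j` and of `h = su j`: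
`∑_{i ∈ fl j} F_i^{(h)}(t_{h,d(h)}) ≥ ∑_{i ∈ fl j} F_i^{(j)}(t_{j,d(j)})` (index `false`) and
`∑_{i ∈ fl j} F_i^{(h)}(t_{h,d(h)}) ≥ ∑_{i ∈ fl j} F_i^{(j)}(t_{j,d(j)})
  + R_j (t_{h,d(h)} - t_{j,d(j)}) - R_j T_j` (index `true`). -/
abbrev ServiceIx (_N : TreeNetwork n m) : Type := Fin n × Bool

def serviceRow (c : N.ServiceIx) : (N.Var → ℝ) →ₗ[ℝ] ℝ :=
  (∑ i : {i // i ∈ N.fl c.1}, N.fv i (some c.1) (N.visits_of_mem i.2) (Fin.last _))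
    - (∑ i : {i // i ∈ N.fl c.1}, N.fv i (N.su c.1) (N.visits_su i.2) (Fin.last _))
    + (if c.2 then
        N.R c.1 • (N.tv (N.su c.1) (Fin.last _) - N.tv (some c.1) (Fin.last _)) else 0)

def serviceRhs (c : N.ServiceIx) : ℝ := if c.2 then N.R c.1 * N.T c.1 else 0

/-- Arrival constraints: `F_i^{(j)}(t_{j,u}) - F_i^{(j)}(t_{j,v}) ≤ b_i + r_i (t_{j,u} - t_{j,v})`
for `j` the first server of flow `i` and `0 ≤ u < v ≤ d(j)`. -/
abbrev ArrivalIx : Type :=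
  Σ i : Fin m, {p : Fin (N.depth (some (N.first i)) + 1) × Fin (N.depth (some (N.first i)) + 1) //
    p.1 < p.2}

def arrivalRow (c : N.ArrivalIx) : (N.Var → ℝ) →ₗ[ℝ] ℝ :=
  N.fv c.1 _ (N.visits_first c.1) c.2.1.1 - N.fv c.1 _ (N.visits_first c.1) c.2.1.2
    - N.r c.1 • (N.tv (some (N.first c.1)) c.2.1.1 - N.tv (some (N.first c.1)) c.2.1.2)

/-- Monotony constraints: `F_i^{(j)}(t_{j,k}) ≥ F_i^{(j)}(t_{j,k+1})` for `j` the first server of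
flow `i` and `0 ≤ k < d(j)`. -/
abbrev MonotonyIx : Type := Σ i : Fin m, Fin (N.depth (some (N.first i)))

def monotonyRow (c : N.MonotonyIx) : (N.Var → ℝ) →ₗ[ℝ] ℝ :=
  N.fv c.1 _ (N.visits_first c.1) c.2.succ - N.fv c.1 _ (N.visits_first c.1) c.2.castSucc

/-- All the inequality constraints. -/
abbrev Ineq : Type :=
  N.OrderIx ⊕ N.FifoTimeIx ⊕ N.ServiceIx ⊕ N.ArrivalIx ⊕ N.MonotonyIx

def ineqRow : N.Ineq → (N.Var → ℝ) →ₗ[ℝ] ℝ :=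
  Sum.elim N.orderRow <| Sum.elim N.fifoTimeRow <| Sum.elim N.serviceRow <|
    Sum.elim N.arrivalRow N.monotonyRow

def ineqRhs : N.Ineq → ℝ :=
  Sum.elim (fun _ => 0) <| Sum.elim (fun _ => 0) <| Sum.elim N.serviceRhs <|
    Sum.elim (fun c => N.b c.1) (fun _ => 0)

/-- The linear program for the delay of flow `i`: maximize `t_0 - t_{j,0}`, where `j` is the first
server of flow `i`. -/
def delayProgram (i : Fin m) : LinearProgram where
  Var := N.Var
  Ineq := N.Ineq
  Eqn := N.FifoIx
  finite_var := inferInstance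
  finite_ineq := inferInstance
  finite_eqn := inferInstance
  lhs := N.ineqRow
  rhs := N.ineqRhs
  eqn := N.fifoRow
  objective := N.t0 - N.tv (some (N.first i)) 0

/-- A linear form in the variables of the delay program, read in the backlog program, whose only
additional variable is `none`. -/
def ext (f : (N.Var → ℝ) →ₗ[ℝ] ℝ) : (Option N.Var → ℝ) →ₗ[ℝ] ℝ :=
  f.comp (LinearMap.funLeft ℝ ℝ some)

/-- The linear program for the backlog of flow `i`, with first server `j` and last server the
sink. It has one more variable, `F_i^{(j)}(t_0)`, and the constraints
`F_i^{(j)}(t_0) - F_i^{(j)}(t_{j,u}) ≤ b_i + r_i (t_0 - t_{j,u})` for `0 ≤ u ≤ d(j)`;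
the objective is `F_i^{(j)}(t_0) - F_i^{(n+1)}(t_0)`. -/
def backlogProgram (i : Fin m) (hi : N.last i = N.sink) : LinearProgram where
  Var := Option N.Var
  Ineq := N.Ineq ⊕ Fin (N.depth (some (N.first i)) + 1)
  Eqn := N.FifoIx
  finite_var := inferInstance
  finite_ineq := inferInstance
  finite_eqn := inferInstance
  lhs := Sum.elim (fun c => N.ext (N.ineqRow c)) (fun u =>
    LinearMap.proj none - N.ext (N.fv i _ (N.visits_first i) u)
      - N.r i • N.ext (N.t0 - N.tv (some (N.first i)) u))
  rhs := Sum.elim N.ineqRhs (fun _ => N.b i)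
  eqn := fun c => N.ext (N.fifoRow c)
  objective := LinearMap.proj none
    - N.ext (N.fv i none (Or.inr (by rw [hi]; exact ((N.su_eq_none _).2 rfl).symm)) 0)

end TreeNetwork

end FifoTree

end

noncomputable section

namespace FifoTree

open Set Filter Topology

/-! ### Right limits and chains of vectors -/

section Vectors

variable {ι : Type*}

/-! Fix an admissible trajectory and a date `t` at the exit. Suitable dates and amounts of data read
off the trajectory form a feasible point whose objective bounds the delay or backlog observed at
`t`. Dates alone are not enough, since data arriving at one instant may leave at different instants.
So each date `t k` of a server is paired with a prefix `c k` of its arrival order, lying between the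
arrivals at `t k` and their right limit (`IsState`).

States are built upstream from the exit (`exists_step`). A prefix at `su j` is pulled back to a
prefix `e k` of the departures from `j` with the same data for the shared flows. The new date is the
last instant up to `t k` at which the arrivals at `j` are still within `e k`
(`exists_arrival_dates`); left-continuity and the total order of prefixes place `e k` between the
arrivals there and their right limit. This yields the FIFO constraints. One extra date per server, a
minimizer of the convolution, yields the service constraints. The arrival constraints survive right
limits because the program grants the burst even between equal dates.

For a flow ending at the sink, the data at index `0` are the departures `D t` all the way back to
its first server (`data_eq_of_last_eq_sink`). Hence the first date there is at most `t - δ` whenever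
`D t < A (t - δ)`. For the backlog, the extra variable is `A t`.

The sizes follow from one fact: the depths in a tree leave no gap, so they sum to at most `n (n + 1)
/ 2`. -/

/-- Coordinatewise right limit of a vector-valued function. -/
def rightLimit (f : ℝ → ι → ℝ) (t : ℝ) : ι → ℝ := fun i => Function.rightLim (fun u => f u i) t

theorem le_rightLimit {f : ℝ → ι → ℝ} (hf : Monotone f) (t : ℝ) : f t ≤ rightLimit f t :=
  fun i => Monotone.le_rightLim (f := fun u => f u i) (fun _ _ h => hf h i) le_rfl

theorem monotone_rightLimit {f : ℝ → ι → ℝ} (hf : Monotone f) : Monotone (rightLimit f) :=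
  fun _ _ h i => Monotone.rightLim (f := fun u => f u i) (fun _ _ h => hf h i) h

theorem tendsto_rightLimit {f : ℝ → ι → ℝ} (hf : Monotone f) (t : ℝ) :
    Tendsto f (𝓝[>] t) (𝓝 (rightLimit f t)) :=
  tendsto_pi_nhds.2 fun i =>
    Monotone.tendsto_rightLim (f := fun u => f u i) (fun _ _ h => hf h i) t

theorem le_rightLimit_of_forall {f : ℝ → ι → ℝ} (hf : Monotone f) {s t : ℝ} (hst : s < t)
    {x : ι → ℝ} (hx : ∀ u, s < u → u ≤ t → x ≤ f u) : x ≤ rightLimit f s := by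
  refine ge_of_tendsto (tendsto_rightLimit hf s) ?_
  filter_upwards [Ioc_mem_nhdsGT hst] with u hu using hx u hu.1 hu.2

theorem rightLimit_le_rightLimit {f g : ℝ → ι → ℝ} (hf : Monotone f) (hg : Monotone g)
    (h : ∀ t, f t ≤ g t) (t : ℝ) : rightLimit f t ≤ rightLimit g t :=
  le_of_tendsto_of_tendsto' (tendsto_rightLimit hf t) (tendsto_rightLimit hg t) h

theorem sup_mem_of_isChain {K : Set (ι → ℝ)} (hK : IsChain (· ≤ ·) K) {x y : ι → ℝ}
    (hx : x ∈ K) (hy : y ∈ K) : x ⊔ y ∈ K := by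
  rcases hK.total hx hy with h | h
  · rwa [sup_eq_right.2 h]
  · rwa [sup_eq_left.2 h]

theorem inf_mem_of_isChain {K : Set (ι → ℝ)} (hK : IsChain (· ≤ ·) K) {x y : ι → ℝ}
    (hx : x ∈ K) (hy : y ∈ K) : x ⊓ y ∈ K := by
  rcases hK.total hx hy with h | h
  · rwa [inf_eq_left.2 h]
  · rwa [inf_eq_right.2 h]

/-- Being comparable is a closed relation on pairs. -/
theorem isChain_closure {K : Set (ι → ℝ)} (hK : IsChain (· ≤ ·) K) :
    IsChain (· ≤ ·) (closure K) := by
  have hc : IsClosed {p : (ι → ℝ) × (ι → ℝ) | p.1 ≤ p.2 ∨ p.2 ≤ p.1} :=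
    (isClosed_le continuous_fst continuous_snd).union (isClosed_le continuous_snd continuous_fst)
  have hs : closure (K ×ˢ K) ⊆ {p : (ι → ℝ) × (ι → ℝ) | p.1 ≤ p.2 ∨ p.2 ≤ p.1} :=
    closure_minimal (fun p hp => hK.total hp.1 hp.2) hc
  intro x hx y hy _
  have : (x, y) ∈ closure (K ×ˢ K) := by rw [closure_prod_eq]; exact ⟨hx, hy⟩
  exact hs this

/-- If every vector of a set `L` agrees on `S` with some vector of the chain `K`, the latter can be
chosen monotonically. -/
theorem exists_monotone_extension {K L : Set (ι → ℝ)} (hK : IsChain (· ≤ ·) K) (S : Set ι)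
    (h : ∀ c ∈ L, ∃ c' ∈ K, ∀ i ∈ S, c' i = c i) :
    ∃ ψ : (ι → ℝ) → ι → ℝ, (∀ c ∈ L, ψ c ∈ K ∧ ∀ i ∈ S, ψ c i = c i) ∧
      ∀ c ∈ L, ∀ c' ∈ L, c ≤ c' → ψ c ≤ ψ c' := by
  classical
  -- The choice depends only on the restriction to `S`; `0` is a default for restrictions that `L`
  -- does not realize.
  have h' : ∀ x : S → ℝ, ∃ y : ι → ℝ, (∃ c ∈ L, S.domRestrict c = x) →
      y ∈ K ∧ S.domRestrict y = x := by
    intro x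
    by_cases hx : ∃ c ∈ L, S.domRestrict c = x
    · obtain ⟨c, hc, rfl⟩ := hx
      obtain ⟨c', hc', e⟩ := h c hc
      exact ⟨c', fun _ => ⟨hc', funext fun i => e i i.2⟩⟩
    · exact ⟨0, fun H => absurd H hx⟩
  choose φ hφ using h'
  refine ⟨fun c => φ (S.domRestrict c), fun c hc => ?_, fun c hc c' hc' hcc => ?_⟩
  · obtain ⟨h1, h2⟩ := hφ _ ⟨c, hc, rfl⟩
    exact ⟨h1, fun i hi => congrFun h2 ⟨i, hi⟩⟩
  · obtain ⟨h1, h2⟩ := hφ _ ⟨c, hc, rfl⟩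
    obtain ⟨h1', h2'⟩ := hφ _ ⟨c', hc', rfl⟩
    rcases hK.total h1 h1' with h | h
    · exact h
    -- In the reverse order the two restrictions coincide, hence so do the choices.
    · have : S.domRestrict c = S.domRestrict c' := by
        refine le_antisymm (fun i : S => hcc i) ?_
        rw [← h2, ← h2']
        exact fun i : S => h i
      simp [this]

/-- Continuity handles the left of `t`; on the right, monotonicity keeps the values above `f t`. -/
theorem lowerSemicontinuous_of_monotone_of_leftContinuous {f : ℝ → ℝ} (hf : Monotone f)
    (hc : ∀ t, ContinuousWithinAt f (Iic t) t) : LowerSemicontinuous f := by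
  intro t y hy
  rw [← nhdsLE_sup_nhdsGE t]
  refine eventually_sup.2 ⟨(hc t).eventually (lt_mem_nhds hy), ?_⟩
  filter_upwards [self_mem_nhdsWithin] with u hu using hy.trans_le (hf hu)

/-- The infimum of a convolution with a rate-latency curve is attained. -/
theorem exists_eq_minPlusConv {f : ℝ → ℝ} (hf : Monotone f)
    (hc : ∀ t, ContinuousWithinAt f (Iic t) t) (R T : ℝ) {t : ℝ} (ht : 0 ≤ t) :
    ∃ s ∈ Icc 0 t, f s + rateLatency R T (t - s) = minPlusConv f (rateLatency R T) t := by
  have hl : LowerSemicontinuous fun s => f s + rateLatency R T (t - s) := by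
    refine (lowerSemicontinuous_of_monotone_of_leftContinuous hf hc).add
      (Continuous.lowerSemicontinuous ?_)
    unfold rateLatency
    fun_prop
  obtain ⟨s, hs, hmin⟩ := (hl.lowerSemicontinuousOn (Icc 0 t)).exists_isMinOn
    (nonempty_Icc.2 ht) isCompact_Icc
  refine ⟨s, hs, le_antisymm ?_ ?_⟩
  · have : Nonempty (Icc (0 : ℝ) t) := ⟨⟨s, hs⟩⟩
    exact le_ciInf fun u => hmin u.2
  · refine ciInf_le (f := fun u : Icc (0 : ℝ) t => f u + rateLatency R T (t - u)) ?_ ⟨s, hs⟩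
    exact ⟨f s + rateLatency R T (t - s), by rintro _ ⟨u, rfl⟩; exact hmin u.2⟩

/-- Dates at which the data `e k` have arrived, when they have departed at the dates `t k`. -/
theorem exists_arrival_dates {K : Set (ι → ℝ)} (hK : IsChain (· ≤ ·) K) {A D : ℝ → ι → ℝ}
    (hA : Monotone A) (hAc : ∀ t, ContinuousWithinAt A (Iic t) t) (hD : Monotone D)
    (hDA : ∀ t, D t ≤ A t) {M : ℝ} (hAK : ∀ t ≤ M, A t ∈ K)
    {t : ℕ → ℝ} (ht : Antitone t) (ht0 : ∀ k, 0 ≤ t k) (htM : ∀ k, t k ≤ M)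
    {e : ℕ → ι → ℝ} (he : Antitone e) (heK : ∀ k, e k ∈ K) (he0 : ∀ k, A 0 ≤ e k)
    (heD : ∀ k, e k ≤ rightLimit D (t k)) :
    ∃ τ : ℕ → ℝ, Antitone τ ∧ (∀ k, 0 ≤ τ k) ∧ (∀ k, τ k ≤ t k) ∧ (∀ k, A (τ k) ≤ e k) ∧
      (∀ k, e k ≤ rightLimit A (τ k)) ∧ ∀ k u, 0 ≤ u → u ≤ t k → A u ≤ e k → u ≤ τ k := by
  set S : ℕ → Set ℝ := fun k => {u | 0 ≤ u ∧ u ≤ t k ∧ A u ≤ e k} with hS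
  have hne : ∀ k, (S k).Nonempty := fun k => ⟨0, le_rfl, ht0 k, he0 k⟩
  have hbd : ∀ k, BddAbove (S k) := fun k => ⟨t k, fun u hu => hu.2.1⟩
  have hmax : ∀ k u, 0 ≤ u → u ≤ t k → A u ≤ e k → u ≤ sSup (S k) := fun k u h0 h1 h2 =>
    le_csSup (hbd k) ⟨h0, h1, h2⟩
  have hle : ∀ k, sSup (S k) ≤ t k := fun k => csSup_le (hne k) fun u hu => hu.2.1
  refine ⟨fun k => sSup (S k), ?_, fun k => hmax k 0 le_rfl (ht0 k) (he0 k), hle, ?_, ?_, hmax⟩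
  · intro k l hkl
    exact csSup_le_csSup (hbd k) (hne l) fun u hu =>
      ⟨hu.1, hu.2.1.trans (ht hkl), hu.2.2.trans (he hkl)⟩
  · intro k
    have hcl : sSup (S k) ∈ closure (S k) := csSup_mem_closure (hne k) (hbd k)
    have hsub : S k ⊆ Iic (sSup (S k)) := fun u hu => le_csSup (hbd k) hu
    have hlim := (hAc (sSup (S k))).mono hsub
    have := mem_closure_iff_nhdsWithin_neBot.1 hcl
    refine le_of_tendsto hlim ?_
    filter_upwards [self_mem_nhdsWithin] with u hu using hu.2.2
  · intro k
    -- If the cap `t k` is reached, causality compares the right limits. Otherwise no later arrival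
    -- vector is below `e k` by maximality, so in the chain each one is above it.
    rcases (hle k).eq_or_lt with h | h
    · simp only [h]
      exact (heD k).trans (rightLimit_le_rightLimit hD hA hDA _)
    · refine le_rightLimit_of_forall hA h fun u hu hut => ?_
      rcases hK.total (heK k) (hAK u (hut.trans (htM k))) with h' | h'
      · exact h'
      · exact absurd (hmax k u ((hmax k 0 le_rfl (ht0 k) (he0 k)).trans hu.le) hut h')
          (not_le.2 hu)

end Vectors

end FifoTree

namespace FifoTree

open Set Filter Topology

namespace TreeNetwork

variable {n m : ℕ} (N : TreeNetwork n m)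

/-! ### Arrivals and departures of a server, as vectors indexed by the flows -/

/-- Cumulative arrivals at server `j`, zero for the flows that do not cross `j`, and extended to
negative times. -/
def arr (F : N.Trajectory) (j : Fin n) (t : ℝ) (i : Fin m) : ℝ :=
  if i ∈ N.fl j then F i (some j) (max t 0) else 0

/-- Cumulative departures from server `j`, zero for the flows that do not cross `j`, and extended to
negative times. -/
def dep (F : N.Trajectory) (j : Fin n) (t : ℝ) (i : Fin m) : ℝ :=
  if i ∈ N.fl j then F i (N.su j) (max t 0) else 0

variable {N} {F : N.Trajectory}

theorem arr_of_mem {j : Fin n} {i : Fin m} (h : i ∈ N.fl j) {t : ℝ} (ht : 0 ≤ t) :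
    N.arr F j t i = F i (some j) t := by simp [arr, h, ht]

theorem dep_of_mem {j : Fin n} {i : Fin m} (h : i ∈ N.fl j) {t : ℝ} (ht : 0 ≤ t) :
    N.dep F j t i = F i (N.su j) t := by simp [dep, h, ht]

theorem arr_eq_dep {j h : Fin n} (hjh : N.su j = some h) {i : Fin m} (hi : i ∈ N.fl j ∩ N.fl h)
    (t : ℝ) : N.arr F h t i = N.dep F j t i := by
  rw [Finset.mem_inter] at hi
  simp [arr, dep, hi.1, hi.2, hjh]

namespace IsAdmissible

variable (hF : N.IsAdmissible F)
include hF

theorem monotone_arr (j : Fin n) : Monotone (N.arr F j) := by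
  intro s t hst i
  unfold arr
  split_ifs with h
  · exact (hF.cumulative i _ (N.visits_of_mem h)).mono (mem_Ici.2 (le_max_right _ _)) (mem_Ici.2 (le_max_right _ _))
     
      (max_le_max_right 0 hst)
  · exact le_rfl

theorem monotone_dep (j : Fin n) : Monotone (N.dep F j) := by
  intro s t hst i
  unfold dep
  split_ifs with h
  · exact (hF.cumulative i _ (N.visits_su h)).mono (mem_Ici.2 (le_max_right _ _)) (mem_Ici.2 (le_max_right _ _))
     
      (max_le_max_right 0 hst)
  · exact le_rfl

theorem dep_le_arr (j : Fin n) (t : ℝ) : N.dep F j t ≤ N.arr F j t := by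
  intro i
  unfold arr dep
  split_ifs with h
  · exact hF.causal j i h _ (le_max_right _ _)
  · exact le_rfl

theorem arr_zero (j : Fin n) : N.arr F j 0 = 0 := by
  ext i
  unfold arr
  split_ifs with h
  · simpa using (hF.cumulative i _ (N.visits_of_mem h)).zero
  · rfl

theorem dep_nonneg (j : Fin n) (t : ℝ) : 0 ≤ N.dep F j t := by
  intro i
  unfold dep
  split_ifs with h
  · have hc := hF.cumulative i _ (N.visits_su h)
    have := hc.mono (mem_Ici.2 le_rfl) (le_max_right t 0 : (0 : ℝ) ≤ _) (le_max_right t 0)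
    rwa [hc.zero] at this
  · exact le_rfl

theorem leftContinuous_arr (j : Fin n) (t : ℝ) : ContinuousWithinAt (N.arr F j) (Iic t) t := by
  refine continuousWithinAt_pi.2 fun i => ?_
  unfold arr
  split_ifs with h
  · rcases le_or_gt t 0 with ht | ht
    · refine (continuousWithinAt_const (b := F i (some j) 0)).congr (fun u hu => ?_) ?_
      · rw [max_eq_right (le_trans hu ht)]
      · rw [max_eq_right ht]
    · have hc := (hF.cumulative i _ (N.visits_of_mem h)).leftCont t ht
      refine ContinuousWithinAt.comp (t := Iic t) (f := fun u => max u 0) ?_ ?_ ?_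
      · rwa [max_eq_left ht.le]
      · exact (continuous_id.max continuous_const).continuousWithinAt
      · exact fun u hu => max_le hu ht.le
  · exact continuousWithinAt_const

/-- Bounded prefixes of the arrival orders, completed into closed chains. -/
theorem exists_prefixes {M : ℝ} (hM : 0 ≤ M) :
    ∃ K : Fin n → Set (Fin m → ℝ), (∀ j, IsChain (· ≤ ·) (K j)) ∧ (∀ j, IsClosed (K j)) ∧
      (∀ j, ∀ c ∈ K j, 0 ≤ c) ∧ (∀ j, ∀ t ≤ M, N.arr F j t ∈ K j) ∧
      (∀ j, ∀ t ≤ M, N.dep F j t ∈ K j) ∧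
      ∀ j h, N.su j = some h → ∀ c ∈ K h, ∃ c' ∈ K j, ∀ i ∈ N.fl j ∩ N.fl h, c' i = c i := by
  obtain ⟨C, hchain, hCarr, hCdep, hcompat⟩ := hF.fifo
  have hmin : ∀ j, ∀ c ∈ C j, ∀ c' ∈ C j, ∃ x ∈ C j, ∀ i ∈ N.fl j, x i = min (c i) (c' i) := by
    intro j c hc c' hc'
    rcases hchain j c hc c' hc' with h | h
    · exact ⟨c, hc, fun i hi => (min_eq_left (h i hi)).symm⟩
    · exact ⟨c', hc', fun i hi => (min_eq_right (h i hi)).symm⟩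
  have hmax : ∀ j, ∀ c ∈ C j, ∀ c' ∈ C j, ∃ x ∈ C j, ∀ i ∈ N.fl j, x i = max (c i) (c' i) := by
    intro j c hc c' hc'
    rcases hchain j c hc c' hc' with h | h
    · exact ⟨c', hc', fun i hi => (max_eq_right (h i hi)).symm⟩
    · exact ⟨c, hc, fun i hi => (max_eq_left (h i hi)).symm⟩
  -- The box forces the coordinates outside `fl j` to vanish, so that comparability on `fl j`
  -- becomes an order of vectors; it also provides compactness.
  set B : Fin n → Set (Fin m → ℝ) := fun j =>
    {x | (0 ≤ x ∧ x ≤ N.arr F j M) ∧ ∃ c ∈ C j, ∀ i ∈ N.fl j, x i = c i} with hB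
  have hBarr : ∀ j, ∀ t ≤ M, N.arr F j t ∈ B j := fun j t ht =>
    ⟨⟨(hF.dep_nonneg j t).trans (hF.dep_le_arr j t), hF.monotone_arr j ht⟩, _,
      hCarr j (max t 0) (le_max_right _ _), fun i hi => by simp [arr, hi]⟩
  have hBdep : ∀ j, ∀ t ≤ M, N.dep F j t ∈ B j := fun j t ht =>
    ⟨⟨hF.dep_nonneg j t, (hF.dep_le_arr j t).trans (hF.monotone_arr j ht)⟩, _,
      hCdep j (max t 0) (le_max_right _ _), fun i hi => by simp [dep, hi]⟩
  have hBout : ∀ j, ∀ x ∈ B j, ∀ i, i ∉ N.fl j → x i = 0 := by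
    rintro j x ⟨⟨h0, h1⟩, -⟩ i hi
    refine le_antisymm ((h1 i).trans_eq ?_) (h0 i)
    simp [arr, hi]
  have hBchain : ∀ j, IsChain (· ≤ ·) (B j) := by
    intro j x hx y hy _
    obtain ⟨c, hc, hxc⟩ := hx.2
    obtain ⟨c', hc', hyc⟩ := hy.2
    rcases hchain j c hc c' hc' with h | h
    · left
      intro i
      by_cases hi : i ∈ N.fl j
      · rw [hxc i hi, hyc i hi]; exact h i hi
      · rw [hBout j x hx i hi, hBout j y hy i hi]
    · right
      intro i
      by_cases hi : i ∈ N.fl j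
      · rw [hxc i hi, hyc i hi]; exact h i hi
      · rw [hBout j x hx i hi, hBout j y hy i hi]
  have hBcompat : ∀ j h, N.su j = some h → ∀ c ∈ B h, ∃ c' ∈ B j,
      ∀ i ∈ N.fl j ∩ N.fl h, c' i = c i := by
    rintro j h hjh x ⟨⟨hx0, hxM⟩, c, hc, hxc⟩
    obtain ⟨c', hc', hcc⟩ := hcompat j h hjh c hc
    -- Clamping `c'` between `0` and the departures at `M` puts it in the box. The shared flows are
    -- unchanged, since there `x` is at most the arrivals at `h`, which are the departures from `j`.
    obtain ⟨z, hz, hzmin⟩ := hmin j c' hc' _ (hCdep j M hM)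
    obtain ⟨w, hw, hwmax⟩ := hmax j z hz _ (hCarr j 0 le_rfl)
    have hw' : ∀ i ∈ N.fl j, w i = max (min (c' i) (N.dep F j M i)) 0 := by
      intro i hi
      rw [hwmax i hi, hzmin i hi, dep_of_mem hi hM, (hF.cumulative i _ (N.visits_of_mem hi)).zero]
    refine ⟨fun i => if i ∈ N.fl j then w i else 0, ⟨⟨fun i => ?_, fun i => ?_⟩, w, hw, ?_⟩, ?_⟩
    · by_cases hi : i ∈ N.fl j
      · simp [hi, hw' i hi]
      · simp [hi]
    · have h0 : 0 ≤ N.arr F j M i := (hBarr j M le_rfl).1.1 i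
      by_cases hi : i ∈ N.fl j
      · simp only [hi, if_true, hw' i hi]
        exact max_le ((min_le_right _ _).trans (hF.dep_le_arr j M i)) h0
      · simpa [hi] using h0
    · intro i hi
      simp [hi]
    · intro i hi
      have hi' := Finset.mem_inter.1 hi
      have h0 : (0 : ℝ) ≤ x i := hx0 i
      have h1 : x i ≤ N.dep F j M i := by rw [← arr_eq_dep hjh hi]; exact hxM i
      simp only [hi'.1, if_true]
      rw [hw' i hi'.1, hcc i hi, ← hxc i hi'.2, min_eq_left h1, max_eq_left h0]
  have hbox : ∀ j, closure (B j) ⊆ Icc 0 (N.arr F j M) := fun j =>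
    closure_minimal (fun x hx => hx.1) isClosed_Icc
  refine ⟨fun j => closure (B j), fun j => isChain_closure (hBchain j), fun j => isClosed_closure,
    fun j c hc => (hbox j hc).1, fun j t ht => subset_closure (hBarr j t ht),
    fun j t ht => subset_closure (hBdep j t ht), ?_⟩
  intro j h hjh c hc
  -- The projection of a compact set to the shared flows is closed, so compatibility passes to
  -- closures.
  set r : (Fin m → ℝ) → {i // i ∈ N.fl j ∩ N.fl h} → ℝ := fun x i => x i with hr
  have hrc : Continuous r := continuous_pi fun i => continuous_apply _
  have hcpt : IsCompact (r '' closure (B j)) :=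
    (isCompact_Icc.of_isClosed_subset isClosed_closure (hbox j)).image hrc
  have hsub : r '' B h ⊆ r '' closure (B j) := by
    rintro _ ⟨x, hx, rfl⟩
    obtain ⟨y, hy, e⟩ := hBcompat j h hjh x hx
    exact ⟨y, subset_closure hy, funext fun i => e i i.2⟩
  obtain ⟨c', hc', e⟩ := closure_minimal hsub hcpt.isClosed
    (image_closure_subset_closure_image hrc ⟨c, hc, rfl⟩)
  exact ⟨c', hc', fun i hi => congrFun e ⟨i, hi⟩⟩

/-- The infimum in the service constraint is attained; the minimizer becomes the additional last
date of `j`. -/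
theorem exists_service_start (j : Fin n) {t : ℝ} (ht : 0 ≤ t) :
    ∃ s ∈ Icc 0 t, ∑ i, N.arr F j s i + rateLatency (N.R j) (N.T j) (t - s) ≤
      ∑ i, N.dep F j t i := by
  have hmono : Monotone fun s => ∑ i, N.arr F j s i := fun s u h =>
    Finset.sum_le_sum fun i _ => hF.monotone_arr j h i
  have hcont : ∀ u, ContinuousWithinAt (fun s => ∑ i, N.arr F j s i) (Iic u) u := fun u =>
    tendsto_finsetSum _ fun i _ => continuousWithinAt_pi.1 (hF.leftContinuous_arr j u) i
  obtain ⟨s, hs, e⟩ := exists_eq_minPlusConv hmono hcont (N.R j) (N.T j) ht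
  refine ⟨s, hs, e.trans_le ?_⟩
  have h1 : ∀ u, 0 ≤ u → ∑ i, N.arr F j u i = ∑ i ∈ N.fl j, F i (some j) u := fun u hu => by
    simp [arr, hu, Finset.sum_ite_mem]
  have h2 : ∑ i, N.dep F j t i = ∑ i ∈ N.fl j, F i (N.su j) t := by
    simp [dep, ht, Finset.sum_ite_mem]
  rw [h2]
  refine le_of_eq_of_le ?_ (hF.service j t ht)
  unfold minPlusConv
  exact iInf_congr fun u => by simp only [h1 u u.2.1]

end IsAdmissible

/-! ### Dates and data along the tree -/

/-- Recursion along the tree, from the exit. -/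
def treeRec (N : TreeNetwork n m) {α : Type*} (a : α) (step : Fin n → α → α) :
    Option (Fin n) → α
  | none => a
  | some j => step j (treeRec N a step (N.su j))
  termination_by o => N.depth o
  decreasing_by rw [N.depth_some]; omega

theorem treeRec_none {α : Type*} (a : α) (step : Fin n → α → α) :
    N.treeRec a step none = a := by rw [treeRec]

theorem treeRec_some {α : Type*} (a : α) (step : Fin n → α → α) (j : Fin n) :
    N.treeRec a step (some j) = step j (N.treeRec a step (N.su j)) := by rw [treeRec]

/-- The label of a server depends only on that of its successor, so recursion on the depth makes all
the choices consistently, branches included. -/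
theorem exists_tree_labelling {α : Type*} (P : Option (Fin n) → α → Prop)
    (Q : Fin n → α → α → Prop) (a : α) (ha : P none a)
    (hstep : ∀ j x, P (N.su j) x → ∃ y, P (some j) y ∧ Q j x y) :
    ∃ f : Option (Fin n) → α, f none = a ∧ (∀ o, P o (f o)) ∧
      ∀ j, Q j (f (N.su j)) (f (some j)) := by
  have h' : ∀ j x, ∃ y, P (N.su j) x → P (some j) y ∧ Q j x y := by
    intro j x
    by_cases hx : P (N.su j) x
    · obtain ⟨y, hy⟩ := hstep j x hx
      exact ⟨y, fun _ => hy⟩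
    · exact ⟨x, fun H => absurd H hx⟩
  choose step hs using h'
  have hP : ∀ k o, N.depth o = k → P o (N.treeRec a step o) := by
    intro k
    induction k with
    | zero =>
      rintro (_ | j) ho
      · rwa [treeRec_none]
      · rw [depth_some] at ho; omega
    | succ k ih =>
      rintro (_ | j) ho
      · rwa [treeRec_none]
      · rw [treeRec_some]
        rw [depth_some] at ho
        exact (hs j _ (ih _ (by omega))).1
  refine ⟨N.treeRec a step, treeRec_none _ _, fun o => hP _ o rfl, fun j => ?_⟩
  rw [treeRec_some]
  exact (hs j _ (hP _ (N.su j) rfl)).2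

/-- Dates `t k` at a point `o` together with the data `c k` that have arrived in `o` at these dates,
when the data that arrive at the same instant are separated. -/
structure IsState (F : N.Trajectory) (K : Fin n → Set (Fin m → ℝ)) (M : ℝ)
    (o : Option (Fin n)) (x : (ℕ → ℝ) × (ℕ → Fin m → ℝ)) : Prop where
  antitone_date : Antitone x.1
  antitone_data : Antitone x.2
  nonneg : ∀ k, 0 ≤ x.1 k
  le : ∀ k, x.1 k ≤ M
  mem : ∀ j, o = some j → ∀ k, x.2 k ∈ K j
  arr_le : ∀ j, o = some j → ∀ k, N.arr F j (x.1 k) ≤ x.2 k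
  le_arr : ∀ j, o = some j → ∀ k, x.2 k ≤ rightLimit (N.arr F j) (x.1 k)

/-- Relation between the states `x` at `su j` and `y` at `j`. -/
structure IsStep (F : N.Trajectory) (j : Fin n) (x y : (ℕ → ℝ) × (ℕ → Fin m → ℝ)) : Prop where
  -- These indices are those of the dates of `su j`; index `N.depth (some j)` is the date proper to
  -- `j`.
  date_le : ∀ k < N.depth (some j), y.1 k ≤ x.1 k
  data_eq : ∀ h, N.su j = some h → ∀ k < N.depth (some j), ∀ i ∈ N.fl j ∩ N.fl h,
    y.2 k i = x.2 k i
  data_eq_dep : N.su j = none → ∀ k < N.depth (some j), y.2 k = N.dep F j (x.1 k)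
  service : ∑ i ∈ N.fl j, y.2 (N.depth (some j)) i +
    rateLatency (N.R j) (N.T j) (x.1 (N.depth (N.su j)) - y.1 (N.depth (some j))) ≤
      ∑ i ∈ N.fl j, y.2 (N.depth (N.su j)) i

theorem rateLatency_nonneg (j : Fin n) (t : ℝ) : 0 ≤ rateLatency (N.R j) (N.T j) t :=
  mul_nonneg (N.R_nonneg j) (le_max_right _ _)

theorem IsAdmissible.exists_step (hF : N.IsAdmissible F) {K : Fin n → Set (Fin m → ℝ)}
    (hK : ∀ j, IsChain (· ≤ ·) (K j)) (hKc : ∀ j, IsClosed (K j)) (hK0 : ∀ j, ∀ c ∈ K j, 0 ≤ c)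
    {M M' : ℝ} (hMM : M < M') (hKa : ∀ j, ∀ t ≤ M', N.arr F j t ∈ K j)
    (hKd : ∀ j, ∀ t ≤ M', N.dep F j t ∈ K j)
    (hcompat : ∀ j h, N.su j = some h → ∀ c ∈ K h, ∃ c' ∈ K j,
      ∀ i ∈ N.fl j ∩ N.fl h, c' i = c i)
    (j : Fin n) (x : (ℕ → ℝ) × (ℕ → Fin m → ℝ)) (hx : N.IsState F K M (N.su j) x) :
    ∃ y, N.IsState F K M (some j) y ∧ N.IsStep F j x y := by
  obtain ⟨t, c⟩ := x
  have ht : Antitone t := hx.antitone_date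
  have ht0 : ∀ k, 0 ≤ t k := hx.nonneg
  have htM : ∀ k, t k < M' := fun k => (hx.le k).trans_lt hMM
  -- The margin `M < M'` leaves prefixes to the right of `t k`, and `K j` is closed.
  have hKr : ∀ k, rightLimit (N.dep F j) (t k) ∈ K j := fun k => by
    refine (hKc j).mem_of_tendsto (tendsto_rightLimit (hF.monotone_dep j) (t k)) ?_
    filter_upwards [Ioo_mem_nhdsGT (htM k)] with u hu using hKd j u hu.2.le
  -- the data that have departed from `j` at the dates `t k`
  obtain ⟨e, he, heK, heD, heR, hedata, hedep⟩ : ∃ e : ℕ → Fin m → ℝ, Antitone e ∧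
      (∀ k, e k ∈ K j) ∧ (∀ k, N.dep F j (t k) ≤ e k) ∧
      (∀ k, e k ≤ rightLimit (N.dep F j) (t k)) ∧
      (∀ h, N.su j = some h → ∀ k, ∀ i ∈ N.fl j ∩ N.fl h, e k i = c k i) ∧
      (N.su j = none → ∀ k, e k = N.dep F j (t k)) := by
    cases hjh : N.su j with
    | none =>
      exact ⟨fun k => N.dep F j (t k), fun k l hkl => hF.monotone_dep j (ht hkl),
        fun k => hKd j _ (htM k).le, fun k => le_rfl, fun k => le_rightLimit (hF.monotone_dep j) _,
        by simp, fun _ _ => rfl⟩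
    | some h =>
      obtain ⟨ψ, hψ, hψm⟩ := exists_monotone_extension (hK j) (L := K h)
        {i | i ∈ N.fl j ∩ N.fl h} (hcompat j h hjh)
      have hck : ∀ k, c k ∈ K h := hx.mem h hjh
      -- The pull-back `ψ (c k)` is controlled only on the shared flows. Clamping it between the
      -- departures and their right limit stays in the chain and does not alter those flows.
      refine ⟨fun k => N.dep F j (t k) ⊔ (ψ (c k) ⊓ rightLimit (N.dep F j) (t k)), ?_, ?_, ?_, ?_,
        ?_, by simp⟩
      · intro k l hkl
        exact sup_le_sup (hF.monotone_dep j (ht hkl)) (inf_le_inf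
          (hψm _ (hck l) _ (hck k) (hx.antitone_data hkl))
          (monotone_rightLimit (hF.monotone_dep j) (ht hkl)))
      · intro k
        exact sup_mem_of_isChain (hK j) (hKd j _ (htM k).le)
          (inf_mem_of_isChain (hK j) (hψ _ (hck k)).1 (hKr k))
      · exact fun k => le_sup_left
      · exact fun k => sup_le (le_rightLimit (hF.monotone_dep j) _) inf_le_right
      · rintro h' hh k i hi
        obtain rfl : h = h' := by simpa using hh
        have h1 : N.dep F j (t k) i ≤ c k i := by
          rw [← arr_eq_dep hjh hi]; exact hx.arr_le h hjh k i
        have h2 : c k i ≤ rightLimit (N.dep F j) (t k) i := by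
          refine (hx.le_arr h hjh k i).trans_eq ?_
          unfold rightLimit
          congr 1
          ext u
          exact arr_eq_dep hjh hi u
        simp only [Pi.sup_apply, Pi.inf_apply]
        rw [(hψ _ (hck k)).2 i hi, inf_eq_left.2 h2, sup_eq_right.2 h1]
  obtain ⟨τ, hτ, hτ0, hτt, hτe, heτ, hτmax⟩ := exists_arrival_dates (hK j) (hF.monotone_arr j)
    (hF.leftContinuous_arr j) (hF.monotone_dep j) (hF.dep_le_arr j) (hKa j) ht ht0
    (fun k => (htM k).le) he heK (fun k => by rw [hF.arr_zero]; exact hK0 j _ (heK k)) heR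
  -- the last date is the start of the service
  set d := N.depth (N.su j) with hd
  have hdj : N.depth (some j) = d + 1 := N.depth_some j
  obtain ⟨s, hs, hserv⟩ := hF.exists_service_start j (ht0 d)
  -- Were the chain ordered the other way, the service inequality on the sums would force equality
  -- in every coordinate.
  have hse : N.arr F j s ≤ e d := by
    rcases (hK j).total (hKa j s (hs.2.trans (htM d).le)) (heK d) with h | h
    · exact h
    · have h1 : ∑ i, N.arr F j s i ≤ ∑ i, e d i := by
        have h2 := N.rateLatency_nonneg j (t d - s)
        have h3 : ∑ i, N.dep F j (t d) i ≤ ∑ i, e d i :=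
          Finset.sum_le_sum fun i _ => heD d i
        linarith
      have h2 := (Finset.sum_eq_sum_iff_of_le fun i _ => h i).1
        (le_antisymm (Finset.sum_le_sum fun i _ => h i) h1)
      exact fun i => (h2 i (Finset.mem_univ i)).ge
  have hsτ : s ≤ τ d := hτmax d s hs.1 hs.2 hse
  -- All indices beyond `d` receive `s`; the program reads only `d + 1` among them.
  refine ⟨(fun k => if k ≤ d then τ k else s, fun k => if k ≤ d then e k else N.arr F j s),
    ⟨?_, ?_, ?_, ?_, ?_, ?_, ?_⟩, ⟨?_, ?_, ?_, ?_⟩⟩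
  · intro k l hkl
    dsimp only
    split_ifs with h1 h2 h2
    · exact hτ hkl
    · omega
    · exact hsτ.trans (hτ h2)
    · exact le_rfl
  · intro k l hkl
    dsimp only
    split_ifs with h1 h2 h2
    · exact he hkl
    · omega
    · exact hse.trans (he h2)
    · exact le_rfl
  · intro k
    dsimp only
    split_ifs
    exacts [hτ0 k, hs.1]
  · intro k
    dsimp only
    split_ifs
    exacts [(hτt k).trans (hx.le k), hs.2.trans (hx.le d)]
  · rintro _ ⟨⟩ k
    dsimp only
    split_ifs
    exacts [heK k, hKa j s (hs.2.trans (htM d).le)]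
  · rintro _ ⟨⟩ k
    dsimp only
    split_ifs
    exacts [hτe k, le_rfl]
  · rintro _ ⟨⟩ k
    dsimp only
    split_ifs
    exacts [heτ k, le_rightLimit (hF.monotone_arr j) s]
  · intro k hk
    simpa [show k ≤ d by omega] using hτt k
  · intro h hjh k hk i hi
    simpa [show k ≤ d by omega] using hedata h hjh k i hi
  · intro hj k hk
    simpa [show k ≤ d by omega] using hedep hj k
  · simp only [← hd, hdj, le_refl, if_true, show ¬ d + 1 ≤ d by omega, if_false]
    rw [← Finset.sum_subset (N.fl j).subset_univ fun i _ hi => by simp [arr, hi],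
      ← Finset.sum_subset (N.fl j).subset_univ fun i _ hi => by simp [dep, hi]] at hserv
    exact hserv.trans (Finset.sum_le_sum fun i _ => heD d i)

/-- Dates and data of all the servers, for a given date of the exit of the network. -/
theorem IsAdmissible.exists_states (hF : N.IsAdmissible F) {t : ℝ} (ht : 0 ≤ t) :
    ∃ (K : Fin n → Set (Fin m → ℝ)) (f : Option (Fin n) → (ℕ → ℝ) × (ℕ → Fin m → ℝ)),
      (∀ k, (f none).1 k = t) ∧ (∀ o, N.IsState F K t o (f o)) ∧
      ∀ j, N.IsStep F j (f (N.su j)) (f (some j)) := by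
  obtain ⟨K, hK, hKc, hK0, hKa, hKd, hcompat⟩ := hF.exists_prefixes (M := t + 1) (by linarith)
  obtain ⟨f, hf0, hf1, hf2⟩ := N.exists_tree_labelling (N.IsState F K t) (N.IsStep F)
    (fun _ => t, fun _ => 0)
    ⟨fun _ _ _ => le_rfl, fun _ _ _ => le_rfl, fun _ => ht, fun _ => by simp, by simp, by simp,
      by simp⟩
    (hF.exists_step hK hKc hK0 (lt_add_one t) hKa hKd hcompat)
  exact ⟨K, f, by simp [hf0], hf1, hf2⟩

end TreeNetwork

end FifoTree

namespace FifoTree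

namespace TreeNetwork

variable {n m : ℕ} (N : TreeNetwork n m)

/-! ### The feasible point of a trajectory -/

theorem exists_su_mem_or_eq_last {i : Fin m} {j : Fin n} (hj : j ∈ N.path i) :
    (∃ h ∈ N.path i, N.su j = some h) ∨ j = N.last i := by
  have key : ∀ (l : List (Fin n)) (hl : l ≠ []), l.IsChain (fun a c => N.su a = some c) →
      j ∈ l → (∃ h ∈ l, N.su j = some h) ∨ j = l.getLast hl := by
    intro l hl hc hj
    induction l with
    | nil => exact absurd rfl hl
    | cons a l ih =>
      cases l with
      | nil => right; simpa using hj
      | cons c l =>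
        rw [List.isChain_cons_cons] at hc
        rcases List.mem_cons.1 hj with rfl | hj
        · exact Or.inl ⟨c, by simp, hc.1⟩
        · rcases ih (by simp) hc.2 hj with ⟨h, hh, e⟩ | e
          · exact Or.inl ⟨h, List.mem_cons_of_mem _ hh, e⟩
          · right; rw [e, List.getLast_cons (List.cons_ne_nil c l)]
  exact key _ (N.path_ne_nil i) (N.path_chain i) hj

theorem mem_fl {i : Fin m} {j : Fin n} : i ∈ N.fl j ↔ j ∈ N.path i := by simp [fl]

theorem mem_fl_first (i : Fin m) : i ∈ N.fl (N.first i) := N.mem_fl.2 (List.head_mem _)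

theorem mem_fl_last (i : Fin m) : i ∈ N.fl (N.last i) := N.mem_fl.2 (List.getLast_mem _)

/-- Data of flow `i` at `o`: they are given by the state of `o` if `o` is a server of the path, by
the state of the last server if `o` is its successor. -/
def procValue (f : Option (Fin n) → (ℕ → ℝ) × (ℕ → Fin m → ℝ)) (i : Fin m) (o : Option (Fin n))
    (k : ℕ) : ℝ :=
  if ∃ j ∈ N.path i, o = some j then (f o).2 k i else (f (some (N.last i))).2 k i

/-- The point of the linear programs given by the states. -/
def point (f : Option (Fin n) → (ℕ → ℝ) × (ℕ → Fin m → ℝ)) : N.Var → ℝ :=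
  Sum.elim (fun p => (f p.1).1 p.2) (fun p => N.procValue f p.1 p.2.1 p.2.2)

variable {N} {F : N.Trajectory} {f : Option (Fin n) → (ℕ → ℝ) × (ℕ → Fin m → ℝ)}

theorem tv_point (o : Option (Fin n)) (k : Fin (N.depth o + 1)) :
    N.tv o k (N.point f) = (f o).1 k := rfl

theorem fv_point (i : Fin m) (o : Option (Fin n)) (h : N.Visits i o) (k : Fin (N.depth o + 1)) :
    N.fv i o h k (N.point f) = N.procValue f i o k := rfl

theorem procValue_of_mem {i : Fin m} {j : Fin n} (h : i ∈ N.fl j) (k : ℕ) :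
    N.procValue f i (some j) k = (f (some j)).2 k i :=
  if_pos ⟨j, N.mem_fl.1 h, rfl⟩

/-- Either the flow continues to a server, where the step preserves its data, or `j` is its last
server, whose state `procValue` reads. The FIFO constraints thus become identities. -/
theorem procValue_su (hf : ∀ j, N.IsStep F j (f (N.su j)) (f (some j))) {i : Fin m} {j : Fin n}
    (h : i ∈ N.fl j) {k : ℕ} (hk : k ≤ N.depth (N.su j)) :
    N.procValue f i (N.su j) k = (f (some j)).2 k i := by
  by_cases hv : ∃ j' ∈ N.path i, N.su j = some j'
  · obtain ⟨j', hj', e⟩ := hv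
    have hi : i ∈ N.fl j ∩ N.fl j' := Finset.mem_inter.2 ⟨h, N.mem_fl.2 hj'⟩
    rw [(hf j).data_eq j' e k (by rw [depth_some]; omega) i hi, e]
    exact procValue_of_mem (N.mem_fl.2 hj') k
  · rw [procValue, if_neg hv]
    rcases N.exists_su_mem_or_eq_last (N.mem_fl.1 h) with h' | h'
    · exact absurd h' hv
    · rw [h']

/-- At `t = 0` the curve vanishes but the program still allows `b`; this slack is needed when two
prefixes share a date. -/
theorem tokenBucket_le {b r : ℝ} (hb : 0 ≤ b) (hr : 0 ≤ r) {t : ℝ} (ht : 0 ≤ t) :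
    tokenBucket b r t ≤ b + r * t := by
  unfold tokenBucket
  split_ifs
  · positivity
  · exact le_rfl

open Filter Topology in
/-- The arrival constraint, up to data that arrive right after a date. -/
theorem IsAdmissible.rightLimit_arr_first_le (hF : N.IsAdmissible F) (i : Fin m) {s t : ℝ}
    (hs : 0 ≤ s) (hst : s ≤ t) :
    rightLimit (N.arr F (N.first i)) t i ≤
      N.arr F (N.first i) s i + (N.b i + N.r i * (t - s)) := by
  have h1 := (tendsto_pi_nhds.1 (tendsto_rightLimit (hF.monotone_arr (N.first i)) t)) i
  have h2 : Tendsto (fun u => N.arr F (N.first i) s i + (N.b i + N.r i * (u - s))) (𝓝[>] t)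
      (𝓝 (N.arr F (N.first i) s i + (N.b i + N.r i * (t - s)))) := by
    have : Continuous fun u => N.arr F (N.first i) s i + (N.b i + N.r i * (u - s)) := by fun_prop
    exact (this.tendsto t).mono_left nhdsWithin_le_nhds
  refine le_of_tendsto_of_tendsto h1 h2 ?_
  filter_upwards [self_mem_nhdsWithin] with u hu
  have hsu : s ≤ u := hst.trans (le_of_lt hu)
  rw [arr_of_mem (N.mem_fl_first i) hs, arr_of_mem (N.mem_fl_first i) (hs.trans hsu)]
  have h3 := hF.arrival i s u hs hsu
  have h4 := tokenBucket_le (N.b_nonneg i) (N.r_nonneg i) (sub_nonneg.2 hsu)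
  linarith

theorem IsAdmissible.feasible_point (hF : N.IsAdmissible F) {K : Fin n → Set (Fin m → ℝ)} {M : ℝ}
    (hs : ∀ o, N.IsState F K M o (f o)) (hf : ∀ j, N.IsStep F j (f (N.su j)) (f (some j))) :
    (∀ c, N.ineqRow c (N.point f) ≤ N.ineqRhs c) ∧ ∀ c, N.fifoRow c (N.point f) = 0 := by
  constructor
  · rintro (⟨j, k⟩ | ⟨j, k⟩ | ⟨j, b⟩ | ⟨i, ⟨u, v⟩, huv⟩ | ⟨i, k⟩)
    · simp only [ineqRow, ineqRhs, Sum.elim_inl, orderRow, LinearMap.sub_apply, tv_point,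
        sub_nonpos]
      exact (hs (some j)).antitone_date (by simp)
    · simp only [ineqRow, ineqRhs, Sum.elim_inl, Sum.elim_inr, fifoTimeRow, LinearMap.sub_apply,
        tv_point, sub_nonpos]
      exact (hf j).date_le k (by rw [depth_some]; exact k.2)
    · have h1 : ∑ i : {i // i ∈ N.fl j}, N.fv i (some j) (N.visits_of_mem i.2) (Fin.last _)
          (N.point f) = ∑ i ∈ N.fl j, (f (some j)).2 (N.depth (some j)) i := by
        rw [← Finset.sum_coe_sort (N.fl j)]
        exact Finset.sum_congr rfl fun i _ => procValue_of_mem i.2 _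
      have h2 : ∑ i : {i // i ∈ N.fl j}, N.fv i (N.su j) (N.visits_su i.2) (Fin.last _)
          (N.point f) = ∑ i ∈ N.fl j, (f (some j)).2 (N.depth (N.su j)) i := by
        rw [← Finset.sum_coe_sort (N.fl j)]
        exact Finset.sum_congr rfl fun i _ => procValue_su hf i.2 le_rfl
      have h3 := (hf j).service
      simp only [ineqRow, ineqRhs, Sum.elim_inl, Sum.elim_inr, serviceRow, serviceRhs,
        LinearMap.sub_apply, LinearMap.add_apply, LinearMap.sum_apply, h1, h2]
      cases b
      · have := N.rateLatency_nonneg j ((f (N.su j)).1 (N.depth (N.su j)) -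
          (f (some j)).1 (N.depth (some j)))
        simp only [Bool.false_eq_true, if_false, LinearMap.zero_apply]
        linarith
      · have : N.R j * ((f (N.su j)).1 (N.depth (N.su j)) - (f (some j)).1 (N.depth (some j))
            - N.T j) ≤ rateLatency (N.R j) (N.T j) ((f (N.su j)).1 (N.depth (N.su j)) -
              (f (some j)).1 (N.depth (some j))) :=
          mul_le_mul_of_nonneg_left (le_max_left _ _) (N.R_nonneg j)
        simp only [if_true, LinearMap.smul_apply, LinearMap.sub_apply, tv_point, smul_eq_mul,
          Fin.val_last]
        linarith
    · simp only [ineqRow, ineqRhs, Sum.elim_inl, Sum.elim_inr, arrivalRow, LinearMap.sub_apply,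
        LinearMap.smul_apply, tv_point, fv_point, smul_eq_mul,
        procValue_of_mem (N.mem_fl_first i)]
      have h1 := (hs (some (N.first i))).le_arr _ rfl u i
      have h2 := (hs (some (N.first i))).arr_le _ rfl v i
      have h3 := hF.rightLimit_arr_first_le i ((hs (some (N.first i))).nonneg v)
        ((hs (some (N.first i))).antitone_date (Fin.le_def.1 huv.le))
      linarith
    · simp only [ineqRow, ineqRhs, Sum.elim_inr, monotonyRow, LinearMap.sub_apply, fv_point,
        procValue_of_mem (N.mem_fl_first i), sub_nonpos]
      exact (hs (some (N.first i))).antitone_data (by simp) i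
  · rintro ⟨j, ⟨i, hi⟩, k⟩
    simp only [fifoRow, LinearMap.sub_apply, fv_point, procValue_of_mem hi,
      procValue_su hf hi (Nat.lt_succ_iff.1 k.2)]
    exact sub_self _

/-- At the first date of every server of its path, the data of a flow that ends at the sink are those
that have departed at the date of the exit. -/
theorem data_eq_of_last_eq_sink (hf : ∀ j, N.IsStep F j (f (N.su j)) (f (some j))) {t : ℝ}
    (ht : 0 ≤ t) (hft : (f none).1 0 = t) {i : Fin m} (hi : N.last i = N.sink) {j : Fin n}
    (hj : i ∈ N.fl j) : (f (some j)).2 0 i = F i none t := by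
  induction hk : N.depth (some j) using Nat.strong_induction_on generalizing j with
  | _ k ih =>
  rcases N.exists_su_mem_or_eq_last (N.mem_fl.1 hj) with ⟨h, hh, e⟩ | e
  · have hd := N.depth_some j
    rw [e] at hd
    rw [(hf j).data_eq h e 0 (by omega) i (Finset.mem_inter.2 ⟨hj, N.mem_fl.2 hh⟩), e]
    exact ih _ (by omega) (N.mem_fl.2 hh) rfl
  · have hsu : N.su j = none := (N.su_eq_none j).2 (e.trans hi)
    rw [(hf j).data_eq_dep hsu 0 (by rw [depth_some]; omega), hsu, hft, dep_of_mem hj ht, hsu]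

end TreeNetwork

end FifoTree

namespace FifoTree

/-! ### Size of the programs -/

/-- Descending from `a` meets every value of `d` from `1` to `d a`. -/
theorem le_card_of_forall_exists_pred {α : Type*} [DecidableEq α] (d : α → ℕ) (S : Finset α)
    (hS : ∀ a ∈ S, 1 < d a → ∃ a' ∈ S, d a = d a' + 1) {a : α} (ha : a ∈ S) :
    d a ≤ S.card := by
  have h : ∀ y x, 1 ≤ x → d a = x + y → ∃ a' ∈ S, d a' = x := by
    intro y
    induction y with
    | zero => exact fun x _ hxy => ⟨a, ha, hxy⟩
    | succ y ih =>
      intro x hx hxy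
      obtain ⟨a', ha', e⟩ := ih (x + 1) (by omega) (by omega)
      obtain ⟨a'', h'', e'⟩ := hS a' ha' (by omega)
      exact ⟨a'', h'', by omega⟩
  have hsub : Finset.Icc 1 (d a) ⊆ S.image d := fun x hx => by
    rw [Finset.mem_Icc] at hx
    exact Finset.mem_image.2 (h (d a - x) x hx.1 (by omega))
  simpa using (Finset.card_le_card hsub).trans Finset.card_image_le

/-- An element of maximal `d` is nobody's predecessor, so it can be erased without losing the
hypothesis, and it contributes at most the cardinality. -/
theorem two_mul_sum_le_of_forall_exists_pred {α : Type*} [DecidableEq α] (d : α → ℕ)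
    (S : Finset α) (hS : ∀ a ∈ S, 1 < d a → ∃ a' ∈ S, d a = d a' + 1) :
    2 * ∑ a ∈ S, d a ≤ S.card * (S.card + 1) := by
  induction hk : S.card generalizing S with
  | zero => simp [Finset.card_eq_zero.1 hk]
  | succ k ih =>
    have hne : S.Nonempty := Finset.card_pos.1 (by omega)
    obtain ⟨a, ha, hmax⟩ := S.exists_max_image d hne
    have hda : d a ≤ k + 1 := hk ▸ le_card_of_forall_exists_pred d S hS ha
    have hcard : (S.erase a).card = k := by rw [Finset.card_erase_of_mem ha]; omega
    have := ih (S.erase a) (fun b hb hb1 => by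
      rw [Finset.mem_erase] at hb
      obtain ⟨a', ha', e⟩ := hS b hb.2 hb1
      refine ⟨a', Finset.mem_erase.2 ⟨?_, ha'⟩, e⟩
      rintro rfl
      have := hmax b hb.2
      omega) hcard
    rw [← Finset.add_sum_erase S d ha]
    nlinarith

theorem two_mul_card_lt_pairs (d : ℕ) :
    2 * Fintype.card {p : Fin (d + 1) × Fin (d + 1) // p.1 < p.2} = (d + 1) * d := by
  have h1 : Fintype.card {p : Fin (d + 1) × Fin (d + 1) // p.1 < p.2} =
      Fintype.card {p : Fin (d + 1) × Fin (d + 1) // p.2 < p.1} :=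
    Fintype.card_congr ((Equiv.prodComm _ _).subtypeEquiv fun p => by simp)
  have h2 : Fintype.card {p : Fin (d + 1) × Fin (d + 1) // p.1 = p.2} = d + 1 := by
    rw [Fintype.card_congr (β := Fin (d + 1))
      ⟨fun p => p.1.1, fun a => ⟨(a, a), rfl⟩, fun p => by
        obtain ⟨⟨a, c⟩, h⟩ := p; simp at h; simp [h], fun _ => rfl⟩, Fintype.card_fin]
  have h3 : Fintype.card (Fin (d + 1) × Fin (d + 1)) =
      Fintype.card {p : Fin (d + 1) × Fin (d + 1) // p.1 < p.2} +
      (Fintype.card {p : Fin (d + 1) × Fin (d + 1) // p.1 = p.2} +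
      Fintype.card {p : Fin (d + 1) × Fin (d + 1) // p.2 < p.1}) := by
    simp only [Fintype.card_subtype]
    rw [← Finset.card_univ, ← Finset.card_filter_add_card_filter_not (fun p => p.1 < p.2)]
    congr 1
    rw [← Finset.card_filter_add_card_filter_not (fun p => p.1 = p.2), Finset.filter_filter,
      Finset.filter_filter]
    congr 2 <;> ext p <;> simp <;> omega
  simp only [Fintype.card_prod, Fintype.card_fin] at h3
  rw [h2, ← h1] at h3
  nlinarith

namespace TreeNetwork

variable {n m : ℕ} (N : TreeNetwork n m)

theorem exists_depth_eq_add_one (j : Fin n) (hj : 1 < N.depth (some j)) :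
    ∃ h, N.depth (some j) = N.depth (some h) + 1 := by
  have h := N.depth_some j
  cases hs : N.su j with
  | none => rw [hs, depth_none] at h; omega
  | some h' => exact ⟨h', by rw [h, hs]⟩

theorem two_mul_sum_depth_le : 2 * ∑ j, N.depth (some j) ≤ n * (n + 1) := by
  simpa using two_mul_sum_le_of_forall_exists_pred (fun j : Fin n => N.depth (some j)) Finset.univ
    fun j _ hj => by simpa using N.exists_depth_eq_add_one j hj

theorem depth_le (j : Fin n) : N.depth (some j) ≤ n := by
  simpa using le_card_of_forall_exists_pred (fun j : Fin n => N.depth (some j)) Finset.univ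
    (fun j _ hj => by simpa using N.exists_depth_eq_add_one j hj) (Finset.mem_univ j)

theorem card_timeIx : Nat.card N.TimeIx = 1 + ∑ j, (N.depth (some j) + 1) := by
  rw [Nat.card_sigma]
  simp [Fintype.sum_option, depth_none]

theorem two_mul_card_timeIx_le : 2 * Nat.card N.TimeIx ≤ (n + 1) * (n + 2) := by
  have := N.two_mul_sum_depth_le
  rw [card_timeIx, Finset.sum_add_distrib]
  simp only [Finset.sum_const, Finset.card_univ, Fintype.card_fin, smul_eq_mul, mul_one]
  nlinarith

theorem two_mul_card_procIx_le : 2 * Nat.card N.ProcIx ≤ m * ((n + 1) * (n + 2)) := by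
  have h : Nat.card N.ProcIx ≤ Nat.card (Fin m × N.TimeIx) := by
    refine Nat.card_le_card_of_injective (fun p => (p.1, ⟨p.2.1.1, p.2.2⟩)) ?_
    rintro ⟨i, ⟨o, ho⟩, k⟩ ⟨i', ⟨o', ho'⟩, k'⟩ e
    simp only [Prod.mk.injEq, Sigma.mk.injEq] at e
    obtain ⟨rfl, rfl, e⟩ := e
    simp at e
    simp [e]
  have h2 := N.two_mul_card_timeIx_le
  rw [Nat.card_prod, Nat.card_fin] at h
  calc 2 * Nat.card N.ProcIx ≤ m * (2 * Nat.card N.TimeIx) := by linarith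
    _ ≤ _ := Nat.mul_le_mul_left _ h2

theorem card_orderIx_add_card_fifoTimeIx_le :
    Nat.card N.OrderIx + Nat.card N.FifoTimeIx ≤ n * (n + 1) := by
  have := N.two_mul_sum_depth_le
  rw [Nat.card_sigma, Nat.card_sigma]
  simp only [Nat.card_fin, ← depth_some]
  omega

theorem two_mul_card_fifoIx_le : 2 * Nat.card N.FifoIx ≤ m * (n * (n + 1)) := by
  have h : Nat.card N.FifoIx ≤ ∑ j, m * N.depth (some j) := by
    rw [Nat.card_sigma]
    refine Finset.sum_le_sum fun j _ => ?_
    rw [Nat.card_prod, Nat.card_fin, ← depth_some]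
    refine Nat.mul_le_mul_right _ ?_
    simpa using Finset.card_le_univ (N.fl j)
  rw [← Finset.mul_sum] at h
  calc 2 * Nat.card N.FifoIx ≤ m * (2 * ∑ j, N.depth (some j)) := by linarith
    _ ≤ _ := Nat.mul_le_mul_left _ N.two_mul_sum_depth_le

theorem card_serviceIx : Nat.card N.ServiceIx = 2 * n := by
  simp [mul_comm]

theorem two_mul_card_arrivalIx_le : 2 * Nat.card N.ArrivalIx ≤ m * (n * (n + 1)) := by
  rw [Nat.card_sigma, Finset.mul_sum]
  calc _ ≤ ∑ _i : Fin m, n * (n + 1) := Finset.sum_le_sum fun i _ => ?_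
    _ = _ := by simp
  rw [Nat.card_eq_fintype_card, two_mul_card_lt_pairs, mul_comm]
  have := N.depth_le (N.first i)
  gcongr

theorem two_mul_card_monotonyIx_le : 2 * Nat.card N.MonotonyIx ≤ m * (n * (n + 1)) := by
  have hn : 1 ≤ n := Nat.one_le_iff_ne_zero.2 fun h => (h ▸ N.sink).elim0
  rw [Nat.card_sigma, Finset.mul_sum]
  calc _ ≤ ∑ _i : Fin m, n * (n + 1) := Finset.sum_le_sum fun i _ => ?_
    _ = _ := by simp
  have := N.depth_le (N.first i)
  rw [Nat.card_fin]
  nlinarith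

end TreeNetwork

end FifoTree

namespace FifoTree

/-! ### Bounds on the worst-case delay and backlog -/

theorem LinearProgram.le_value {P : LinearProgram} {x : P.Var → ℝ} (hx : P.Feasible x) {a : ℝ}
    (ha : a ≤ P.objective x) : (a : EReal) ≤ P.value :=
  (EReal.coe_le_coe_iff.2 ha).trans (le_iSup₂_of_le x hx le_rfl)

theorem LinearProgram.ofReal_le_toENNReal_value {P : LinearProgram} {x : P.Var → ℝ}
    (hx : P.Feasible x) {a : ℝ} (ha : a ≤ P.objective x) :
    ENNReal.ofReal a ≤ P.value.toENNReal := by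
  simpa [EReal.toENNReal] using EReal.toENNReal_le_toENNReal (LinearProgram.le_value hx ha)

namespace TreeNetwork

variable {n m : ℕ} (N : TreeNetwork n m)

/-- This makes the zero point feasible: optimal values are nonnegative and may be compared in
`ℝ≥0∞`. -/
theorem ineqRhs_nonneg (c : N.Ineq) : 0 ≤ N.ineqRhs c := by
  rcases c with c | c | ⟨j, b⟩ | c | c
  · exact le_rfl
  · exact le_rfl
  · cases b
    · exact le_rfl
    · exact mul_nonneg (N.R_nonneg j) (N.T_nonneg j)
  · exact N.b_nonneg c.1
  · exact le_rfl

theorem delayProgram_value_nonneg (i : Fin m) : 0 ≤ (N.delayProgram i).value :=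
  LinearProgram.le_value (x := 0)
    ⟨fun c => by rw [map_zero]; exact N.ineqRhs_nonneg c, fun c => map_zero _⟩ (map_zero _).ge

theorem backlogProgram_value_nonneg (i : Fin m) (hi : N.last i = N.sink) :
    0 ≤ (N.backlogProgram i hi).value := by
  refine LinearProgram.le_value (x := 0) ⟨fun c => ?_, fun c => map_zero _⟩ (map_zero _).ge
  rw [map_zero]
  rcases c with c | c
  · exact N.ineqRhs_nonneg c
  · exact N.b_nonneg i

variable {N}

theorem IsAdmissible.delay_le_value {F : N.Trajectory} (hF : N.IsAdmissible F) {i : Fin m}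
    (hi : N.last i = N.sink) :
    delay (F i (some (N.first i))) (F i (N.su (N.last i))) ≤
      (N.delayProgram i).value.toENNReal := by
  have hsu : N.su (N.last i) = none := (N.su_eq_none _).2 hi
  refine iSup₂_le fun t ht => iSup₂_le fun δ hδ => ?_
  obtain ⟨hδ0, hδt, hδA⟩ := hδ
  obtain ⟨K, f, hft, hs, hf⟩ := hF.exists_states ht
  refine LinearProgram.ofReal_le_toENNReal_value (P := N.delayProgram i)
    (x := N.point f) (hF.feasible_point hs hf) ?_
  -- A later first date would give `A (t - δ) ≤ D t`, as the arrivals at that date are within the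
  -- data `D t`.
  have h1 : (f (some (N.first i))).1 0 ≤ t - δ := by
    by_contra! hlt
    have h2 := (hs (some (N.first i))).arr_le _ rfl 0 i
    have h3 := hF.monotone_arr (N.first i) hlt.le i
    rw [data_eq_of_last_eq_sink hf ht (hft 0) hi (N.mem_fl_first i)] at h2
    rw [arr_of_mem (N.mem_fl_first i) (sub_nonneg.2 hδt)] at h3
    rw [hsu] at hδA
    linarith
  have h2 : (N.delayProgram i).objective (N.point f) = t - (f (some (N.first i))).1 0 := by
    rw [← hft 0]; rfl
  rw [h2]
  linarith

theorem IsAdmissible.backlog_le_value {F : N.Trajectory} (hF : N.IsAdmissible F) {i : Fin m}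
    (hi : N.last i = N.sink) :
    backlog (F i (some (N.first i))) (F i (N.su (N.last i))) ≤
      (N.backlogProgram i hi).value.toENNReal := by
  have hsu : N.su (N.last i) = none := (N.su_eq_none _).2 hi
  refine iSup₂_le fun t ht => ?_
  obtain ⟨K, f, hft, hs, hf⟩ := hF.exists_states ht
  obtain ⟨hineq, heqn⟩ := hF.feasible_point hs hf
  refine LinearProgram.ofReal_le_toENNReal_value (P := N.backlogProgram i hi)
    (x := fun v => Option.elim v (F i (some (N.first i)) t) (N.point f)) ⟨?_, heqn⟩ ?_
  · rintro (c | u)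
    · exact hineq c
    · change F i (some (N.first i)) t - N.procValue f i (some (N.first i)) u
        - N.r i * ((f none).1 0 - (f (some (N.first i))).1 u) ≤ N.b i
      have h1 := (hs (some (N.first i))).arr_le _ rfl u i
      have h2 : (f (some (N.first i))).1 u ≤ t := (hs (some (N.first i))).le u
      have h3 := hF.arrival i _ t ((hs (some (N.first i))).nonneg u) h2
      have h4 := tokenBucket_le (N.b_nonneg i) (N.r_nonneg i) (sub_nonneg.2 h2)
      rw [arr_of_mem (N.mem_fl_first i) ((hs (some (N.first i))).nonneg u)] at h1
      rw [procValue_of_mem (N.mem_fl_first i), hft]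
      linarith
  · change _ ≤ F i (some (N.first i)) t - N.procValue f i none 0
    have h1 : N.procValue f i none 0 = F i none t := by
      rw [← hsu, procValue_su hf (N.mem_fl_last i) (Nat.zero_le _), hsu]
      exact data_eq_of_last_eq_sink hf ht (hft 0) hi (N.mem_fl_last i)
    rw [h1, hsu]

end TreeNetwork

end FifoTree

end

/-- The polynomial-size linear program of a FIFO tree network gives upper bounds of the worst-case
delay and backlog of a flow `i` that ends at the sink, and its numbers of variables and constraints
are polynomial. -/
theorem mainTheorem1 {n m : ℕ} (N : FifoTree.TreeNetwork n m) (i : Fin m)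
    (hi : N.last i = N.sink) :
    ((N.worstCaseDelay i : EReal) ≤ (N.delayProgram i).value) ∧
    ((N.worstCaseBacklog i : EReal) ≤ (N.backlogProgram i hi).value) ∧
    (2 * Nat.card N.TimeIx ≤ (n + 1) * (n + 2)) ∧
    (2 * Nat.card N.ProcIx ≤ m * ((n + 1) * (n + 2))) ∧
    (Nat.card N.OrderIx + Nat.card N.FifoTimeIx ≤ n * (n + 1)) ∧
    (2 * Nat.card N.FifoIx ≤ m * (n * (n + 1))) ∧
    (Nat.card N.ServiceIx = 2 * n) ∧
    (2 * Nat.card N.ArrivalIx ≤ m * (n * (n + 1))) ∧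
    (2 * Nat.card N.MonotonyIx ≤ m * (n * (n + 1))) := by
  refine ⟨?_, ?_, N.two_mul_card_timeIx_le, N.two_mul_card_procIx_le,
    N.card_orderIx_add_card_fifoTimeIx_le, N.two_mul_card_fifoIx_le, N.card_serviceIx,
    N.two_mul_card_arrivalIx_le, N.two_mul_card_monotonyIx_le⟩
  · rw [← EReal.coe_toENNReal (N.delayProgram_value_nonneg i), EReal.coe_ennreal_le_coe_ennreal_iff]
    exact iSup₂_le fun F hF => hF.delay_le_value hi
  · rw [← EReal.coe_toENNReal (N.backlogProgram_value_nonneg i hi),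
      EReal.coe_ennreal_le_coe_ennreal_iff]
    exact iSup₂_le fun F hF => hF.backlog_le_value hi
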